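/- **Setting.** Formulae and programs of propositional dynamic logic are built from countably many propositional atoms $p$ and atomic programs $a$ by $\varphi ::= p \mid \neg\varphi \mid \varphi\wedge\varphi \mid \varphi\vee\varphi \mid \langle\alpha\rangle\varphi \mid [\alpha]\varphi$ and $\alpha ::= a \mid \alpha;\alpha \mid \alpha\cup\alpha \mid \alpha^* \mid \varphi?$, with the usual Kripke semantics; $\varphi$ is satisfiable if it holds at some world of some model. Negation normal form means that $\neg$ occurs only immediately before atoms (also inside tests); ${\sim}\varphi$ is the negation normal form of $\neg\varphi$. Write $\mathrm{pre}(\chi)$ for the set of all $\langle\alpha_1\rangle\cdots\langle\alpha_k\rangle\chi$, $k\ge 0$. A formula $\langle\alpha\rangle\varphi$ with $\alpha$ not atomic is called *reducible*. A *tableau node* $\Gamma :: H, N, D, B :: \mathrm{stat}, u$ consists of a set $\Gamma$ of formulae, a list $H$ of pairs (formula, set of formulae), a value $N$ that is $\bot$ or a formula, sets $D$ and $B$ of formulae, a status in $\{\mathbf{unsat},\mathbf{open},\mathbf{barred}\}$, and a partial function $u$ from pairs ($\langle\rangle$-formula, $\langle{}^*\rangle$-formula) to positive integers ($\bot$ means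 undefined). A node is *closed* if its status is $\mathbf{unsat}$ and *barred* if it is $\mathbf{barred}$. Let $\mathrm{tst}(\chi)=\chi$, $\mathrm{bl}(\chi,S)=S$ if $\chi$ is reducible, and $\mathrm{tst}(\chi)=\bot$, $\mathrm{bl}(\chi,S)=\emptyset$ otherwise. **Rules.** Below the node has formula set $\{\pi\}\uplus\Gamma$ with principal formula $\pi$; $u_i$ and $\mathrm{stat}_i$ belong to the $i$-th child; components of the children that are not mentioned are copied from the node. $u_i|_\Gamma$ keeps $u_i(\chi_1,\chi_2)$ for $\chi_1\in\Gamma$ and is $\bot$ otherwise. $u_i[\pi\leftarrow\delta]$ is $u_i|_\Gamma$ except that its value at $(\pi,\chi_2)$ is $u_i(\delta,\chi_2)$. * $(id)$: if the node contains some $p$ and $\neg p$: no children, status $\mathbf{unsat}$, $u$ nowhere defined. * $(\langle{}^*\rangle_2)$: $\pi=\langle\alpha^*\rangle\varphi\in D$ and $N\in\{\bot,\pi\}$: no children, status $\mathbf{barred}$, $u$ nowhere defined. * Rules with $N=\bot$ and one child, $\mathrm{stat}=\mathrm{stat}_1$, $u=u_1|_\Gamma$: $\varphi\wedge\psi$ is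 replaced by $\varphi,\psi$; $[\alpha\cup\beta]\varphi$ by $[\alpha]\varphi,[\beta]\varphi$; $[\alpha;\beta]\varphi$ by $[\alpha][\beta]\varphi$; $[\alpha^*]\varphi$ by $\varphi,[\alpha][\alpha^*]\varphi$ if $[\alpha^*]\varphi\notin B$ and by nothing if $[\alpha^*]\varphi\in B$, where in both cases the child has $B_1=B\cup\{[\alpha^*]\varphi\}$. * Rules with $N\in\{\bot,\pi\}$ and one child, $\mathrm{stat}=\mathrm{stat}_1$: $\langle\alpha;\beta\rangle\varphi$ is replaced by $\delta=\langle\alpha\rangle\langle\beta\rangle\varphi$; $\langle\psi?\rangle\varphi$ by $\psi$ and $\delta=\varphi$. In both, $N_1=\mathrm{tst}(\delta)$, $D_1=\mathrm{bl}(\delta,D)$, $u=u_1[\pi\leftarrow\delta]$. * Rules with two children. With $N=\bot$: $\varphi_1\vee\varphi_2$ is replaced by $\varphi_1$ or by $\varphi_2$; $[\psi?]\varphi$ by ${\sim}\psi$ or by $\varphi$; here $u_i'=u_i|_\Gamma$. With $N\in\{\bot,\pi\}$: $\langle\alpha_1\cup\alpha_2\rangle\varphi$ is replaced by $\delta_i=\langle\alpha_i\rangle\varphi$,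 with $N_i=\mathrm{tst}(\delta_i)$, $D_i=\mathrm{bl}(\delta_i,D)$, $u_i'=u_i[\pi\leftarrow\delta_i]$; and $(\langle{}^*\rangle_1)$: $\pi=\langle\alpha^*\rangle\varphi\notin D$ is replaced by $\delta_1=\varphi$ or by $\delta_2=\langle\alpha\rangle\langle\alpha^*\rangle\varphi$, with $N_i=\mathrm{tst}(\delta_i)$, $D_i=\mathrm{bl}(\delta_i,D\cup\{\pi\})$, $u_i'=u_i[\pi\leftarrow\delta_i]$, except that $u_1'(\pi,\pi)=\bot$. In all four, the status is $\mathbf{unsat}$ if both children have status $\mathbf{unsat}$, $\mathbf{open}$ if some child is open, and $\mathbf{barred}$ otherwise; $u$ is nowhere defined if no child is open, is $u_i'$ if exactly the $i$-th child is open, and is the pointwise minimum of $u_1'$ and $u_2'$ (undefined where one of them is undefined) if both are open. * $(\langle\rangle)$: applies if the set $X$ of formulae of the node consists of formulae $\langle a\rangle\varphi$, $[a]\varphi$ with $a$ atomic, atoms and negated atoms, and contains no $p$ together with $\neg p$. For $\langle a\rangle\varphi\in X$ put $X_{a,\varphi}=\{\varphi\}\cup\{\psi\mid[a]\psi\in X\}$,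 and call $\langle a\rangle\varphi$ blocked if $(\varphi,X_{a,\varphi})$ is an entry of $H$. There is one child for each unblocked $\langle a\rangle\varphi\in X$, with formula set $X_{a,\varphi}$, list $H$ extended at the end by $(\varphi,X_{a,\varphi})$, $N=\mathrm{tst}(\varphi)$ and $D=B=\emptyset$; call its variables $\mathrm{stat}_{a,\varphi}$, $u_{a,\varphi}$. For blocked $\langle a\rangle\varphi$ let $u_{a,\varphi}$ be constantly $j$, where $(\varphi,X_{a,\varphi})$ is the $j$-th entry of $H$. The status is $\mathbf{unsat}$ if for some unblocked $\langle a\rangle\varphi\in X$ either $\mathrm{stat}_{a,\varphi}\ne\mathbf{open}$, or $u_{a,\varphi}(\varphi,\psi)$ is defined and larger than the length of $H$ for some $\psi$ of the form $\langle\alpha^*\rangle\theta$ with $\varphi\in\mathrm{pre}(\psi)$; otherwise it is $\mathbf{open}$. If the status is $\mathbf{open}$, then $u(\langle a\rangle\varphi,\chi)=u_{a,\varphi}(\varphi,\chi)$ whenever $\langle a\rangle\varphi\in X$, $\chi$ has the form $\langle\alpha^*\rangle\theta$ and $\langle a\rangle\varphi\in\mathrm{pre}(\chi)$; all other values of $u$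 are undefined. An *expanded tableau* for $\phi$ is a tree of nodes with root $\{\phi\}::[\,],\bot,\emptyset,\emptyset::\mathrm{stat},u$ in which the children of every node arise from a single application of a rule to it (which may produce no children), the status and $u$ of the node being determined by those of the children as stated. The tree is not assumed to be finite. **Theorem (Completeness).** Let $\phi$ be a formula in negation normal form and let $T$ be an expanded tableau for $\phi$, for any choice of the applied rules. If the root of $T$ is closed or barred (that is, not open), then $\phi$ is not satisfiable. -/

import Mathlib

universe u

namespace PDL

/-! ### Syntax -/

mutual
/-- Formulae; the atomic propositions are indexed by the natural numbers. -/
inductive Fml : Type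
  | atom : ℕ → Fml
  | neg : Fml → Fml
  | conj : Fml → Fml → Fml
  | disj : Fml → Fml → Fml
  | dia : Prg → Fml → Fml
  | box : Prg → Fml → Fml
/-- Programs; the atomic programs are indexed by the natural numbers. -/
inductive Prg : Type
  | atom : ℕ → Prg
  | seq : Prg → Prg → Prg
  | union : Prg → Prg → Prg
  | star : Prg → Prg
  | test : Fml → Prg
end

/-! ### Semantics -/

/-- A model `(W, R, V)`. -/
structure Model where
  W : Type u
  nonempty : Nonempty W
  R : ℕ → W → W → Prop
  V : ℕ → Set W

mutual
/-- `Sat M φ w` says that `φ` holds at the world `w` of `M`. -/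
def Sat (M : Model.{u}) : Fml → M.W → Prop
  | .atom p, w => w ∈ M.V p
  | .neg φ, w => ¬ Sat M φ w
  | .conj φ ψ, w => Sat M φ w ∧ Sat M ψ w
  | .disj φ ψ, w => Sat M φ w ∨ Sat M ψ w
  | .dia α φ, w => ∃ v, Rel M α w v ∧ Sat M φ v
  | .box α φ, w => ∀ v, Rel M α w v → Sat M φ v
/-- The accessibility relation of a program. -/
def Rel (M : Model.{u}) : Prg → M.W → M.W → Prop
  | .atom a, w, v => M.R a w v
  | .seq α β, w, v => ∃ t, Rel M α w t ∧ Rel M β t v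
  | .union α β, w, v => Rel M α w v ∨ Rel M β w v
  | .star α, w, v => Relation.ReflTransGen (fun s t => Rel M α s t) w v
  | .test φ, w, v => w = v ∧ Sat M φ w
end

/-- Satisfiability in some PDL model. -/
def Satisfiable (φ : Fml) : Prop := ∃ (M : Model.{u}) (w : M.W), Sat M φ w

/-! ### Negation normal form -/

mutual
/-- Negation occurs only immediately in front of propositional atoms. -/
def Fml.IsNNF : Fml → Prop
  | .atom _ => True
  | .neg (.atom _) => True
  | .neg _ => False
  | .conj φ ψ => φ.IsNNF ∧ ψ.IsNNF
  | .disj φ ψ => φ.IsNNF ∧ ψ.IsNNF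
  | .dia α φ => α.IsNNF ∧ φ.IsNNF
  | .box α φ => α.IsNNF ∧ φ.IsNNF
/-- All formulae tested in the program are in negation normal form. -/
def Prg.IsNNF : Prg → Prop
  | .atom _ => True
  | .seq α β => α.IsNNF ∧ β.IsNNF
  | .union α β => α.IsNNF ∧ β.IsNNF
  | .star α => α.IsNNF
  | .test φ => φ.IsNNF
end

mutual
/-- `Fml.nnfAux true φ` is the negation normal form of `φ`, and
`Fml.nnfAux false φ` is the negation normal form of `¬ φ`. -/
def Fml.nnfAux : Bool → Fml → Fml
  | true, .atom p => .atom p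
  | false, .atom p => .neg (.atom p)
  | b, .neg φ => Fml.nnfAux (!b) φ
  | true, .conj φ ψ => .conj (Fml.nnfAux true φ) (Fml.nnfAux true ψ)
  | false, .conj φ ψ => .disj (Fml.nnfAux false φ) (Fml.nnfAux false ψ)
  | true, .disj φ ψ => .disj (Fml.nnfAux true φ) (Fml.nnfAux true ψ)
  | false, .disj φ ψ => .conj (Fml.nnfAux false φ) (Fml.nnfAux false ψ)
  | true, .dia α φ => .dia (Prg.nnf α) (Fml.nnfAux true φ)
  | false, .dia α φ => .box (Prg.nnf α) (Fml.nnfAux false φ)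
  | true, .box α φ => .box (Prg.nnf α) (Fml.nnfAux true φ)
  | false, .box α φ => .dia (Prg.nnf α) (Fml.nnfAux false φ)
/-- Puts all tested formulae of a program into negation normal form. -/
def Prg.nnf : Prg → Prg
  | .atom a => .atom a
  | .seq α β => .seq (Prg.nnf α) (Prg.nnf β)
  | .union α β => .union (Prg.nnf α) (Prg.nnf β)
  | .star α => .star (Prg.nnf α)
  | .test φ => .test (Fml.nnfAux true φ)
end

/-- The negation normal form of a formula. -/
def Fml.nnf (φ : Fml) : Fml := Fml.nnfAux true φ

/-- The formula `∼φ`, the negation normal form of `¬ φ`. -/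
def Fml.compl (φ : Fml) : Fml := (Fml.neg φ).nnf

/-! ### Tableau nodes -/

/-- The formula has the form `⟨α*⟩φ`. -/
def Fml.IsStarDia : Fml → Prop
  | .dia (.star _) _ => True
  | _ => False

/-- The formula has the form `⟨α⟩φ` with a non-atomic program `α`. -/
def Fml.IsNonAtomicDia : Fml → Prop
  | .dia (.atom _) _ => False
  | .dia _ _ => True
  | _ => False

/-- The formula is a propositional atom or the negation of one. -/
def Fml.IsLiteral : Fml → Prop
  | .atom _ => True
  | .neg (.atom _) => True
  | _ => False

/-- `pre χ` is the set of all formulae `⟨α₁⟩ … ⟨αₖ⟩χ` with `k ≥ 0`. -/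
inductive pre (χ : Fml) : Set Fml
  | refl : pre χ χ
  | dia (α : Prg) {ψ : Fml} : pre χ ψ → pre χ (.dia α ψ)

inductive Status : Type
  | unsat
  | isOpen
  | barred

/-- Partial functions on pairs of formulae with values in the positive natural numbers;
`none` means undefined. In a tableau they are defined at `(χ₁, χ₂)` only when `χ₁` is a
`⟨⟩`-formula and `χ₂` is a `⟨*⟩`-formula. -/
abbrev Uev : Type := Fml → Fml → Option ℕ+

/-- The function that is undefined everywhere. -/
def uevBot : Uev := fun _ _ => none

/-- A tableau node `Γ :: HCr, Nx, BD, BB :: stat, uev`. -/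
structure Node where
  fmls : Set Fml
  HCr : List (Fml × Set Fml)
  Nx : Option Fml
  BD : Set Fml
  BB : Set Fml
  stat : Status
  uev : Uev

def Node.IsClosed (x : Node) : Prop := x.stat = Status.unsat

def Node.IsBarred (x : Node) : Prop := x.stat = Status.barred

open Classical in
/-- `tst χ` is `χ` if `χ` is a diamond formula with non-atomic program, else undefined. -/
noncomputable def tst (χ : Fml) : Option Fml := if χ.IsNonAtomicDia then some χ else none

open Classical in
/-- `bl χ S` is `S` if `χ` is a diamond formula with non-atomic program, else empty. -/
noncomputable def bl (χ : Fml) (S : Set Fml) : Set Fml := if χ.IsNonAtomicDia then S else ∅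

/-! ### Propagation of the variables `stat` and `uev` -/

open Classical in
/-- Keep the entries whose first formula is in `Γ`. -/
noncomputable def uevRestrict (Γ : Set Fml) (f : Uev) : Uev := fun χ₁ χ₂ =>
  if χ₁ ∈ Γ then f χ₁ χ₂ else none

open Classical in
/-- The principal formula `π` takes over the entries of its decomposition `δ`; the entries
of the formulae in `Γ` are kept. -/
noncomputable def uevInherit (π δ : Fml) (Γ : Set Fml) (f : Uev) : Uev := fun χ₁ χ₂ =>
  if χ₁ = π then f δ χ₂ else if χ₁ ∈ Γ then f χ₁ χ₂ else none

open Classical in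
/-- As `uevInherit`, but undefined at `(π, π)`: for the left child of the rule `⟨*⟩₁`. -/
noncomputable def uevInheritStar (π δ : Fml) (Γ : Set Fml) (f : Uev) : Uev := fun χ₁ χ₂ =>
  if χ₁ = π ∧ χ₂ = π then none else uevInherit π δ Γ f χ₁ χ₂

/-- Pointwise minimum, undefined where one of the arguments is undefined. -/
def uevMin (f g : Uev) : Uev := fun χ₁ χ₂ =>
  match f χ₁ χ₂, g χ₁ χ₂ with
  | some m, some n => some (min m n)
  | _, _ => none

/-- The status of a node with two children, from the status of the children. -/
def betaStat : Status → Status → Status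
  | .unsat, .unsat => .unsat
  | .isOpen, _ => .isOpen
  | _, .isOpen => .isOpen
  | _, _ => .barred

/-- The function `uev` of a node with two children, from the status of the children and the
functions `uev₁'` and `uev₂'` of the rule. -/
def betaUev : Status → Status → Uev → Uev → Uev
  | .isOpen, .isOpen, f, g => uevMin f g
  | .isOpen, _, f, _ => f
  | _, .isOpen, _, g => g
  | _, _, _, _ => uevBot

/-! ### The existential branching rule -/

/-- For `⟨a⟩φ ∈ X`, the set `{φ} ∪ Δ` with `Δ = {ψ | [a]ψ ∈ X}`. -/
def succSet (X : Set Fml) (a : ℕ) (φ : Fml) : Set Fml :=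
  insert φ {ψ | Fml.box (.atom a) ψ ∈ X}

/-- `⟨a⟩φ` is blocked: its successor has already been created on the current branch. -/
def Blocked (X : Set Fml) (H : List (Fml × Set Fml)) (a : ℕ) (φ : Fml) : Prop :=
  (φ, succSet X a φ) ∈ H

/-- The child that is created for `⟨a⟩φ`, with given variables. -/
noncomputable def coreNode (X : Set Fml) (H : List (Fml × Set Fml)) (a : ℕ) (φ : Fml)
    (s : Status) (f : Uev) : Node :=
  ⟨succSet X a φ, H ++ [(φ, succSet X a φ)], tst φ, ∅, ∅, s, f⟩

open Classical in
/-- The status of a state with unblocked diamond formulae `⟨a⟩φ`, `(a, φ) ∈ L`, where `s a φ` and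
`f a φ` are the variables of the child for `⟨a⟩φ`. -/
noncomputable def stateStat (H : List (Fml × Set Fml)) (L : List (ℕ × Fml))
    (s : ℕ → Fml → Status) (f : ℕ → Fml → Uev) : Status :=
  if ∃ a φ, (a, φ) ∈ L ∧
      (s a φ ≠ Status.isOpen ∨
        ∃ ψ : Fml, ψ.IsStarDia ∧ φ ∈ pre ψ ∧ ∃ n : ℕ+, f a φ φ ψ = some n ∧ H.length < (n : ℕ))
  then Status.unsat else Status.isOpen

open Classical in
/-- The function `uev` of a state with formula set `X` and status `st`. -/
noncomputable def stateUev (X : Set Fml) (st : Status) (f : ℕ → Fml → Uev) : Uev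
  | .dia (.atom a) φ, χ₂ =>
      if st = Status.isOpen ∧ χ₂.IsStarDia ∧ Fml.dia (.atom a) φ ∈ pre χ₂ ∧
        Fml.dia (.atom a) φ ∈ X
      then f a φ φ χ₂ else none
  | _, _ => none

/-! ### The rules -/

/-- `Rule x cs`: a single application of a tableau rule to the node `x` produces the children
`cs` (from left to right), and the variables of `x` are determined by those of `cs`. -/
inductive Rule : Node → List Node → Prop
  /-- The rule `id`. -/
  | id (Γ H N D B) (p : ℕ) (hp : Fml.atom p ∈ Γ) (hn : Fml.neg (.atom p) ∈ Γ) :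
      Rule ⟨Γ, H, N, D, B, .unsat, uevBot⟩ []
  /-- The rule `⟨*⟩₂`. -/
  | diaStar₂ (Γ H N D B) (α : Prg) (φ : Fml) (hΓ : Fml.dia (.star α) φ ∉ Γ)
      (hN : N = none ∨ N = some (Fml.dia (.star α) φ))
      (hD : Fml.dia (.star α) φ ∈ D) :
      Rule ⟨insert (Fml.dia (.star α) φ) Γ, H, N, D, B, .barred, uevBot⟩ []
  /-- The rule `∧`. -/
  | conj (Γ H D B s f) (φ ψ : Fml) (hΓ : Fml.conj φ ψ ∉ Γ) :
      Rule ⟨insert (Fml.conj φ ψ) Γ, H, none, D, B, s, uevRestrict Γ f⟩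
        [⟨{φ, ψ} ∪ Γ, H, none, D, B, s, f⟩]
  /-- The rule `[∪]`. -/
  | boxUnion (Γ H D B s f) (α β : Prg) (φ : Fml) (hΓ : Fml.box (.union α β) φ ∉ Γ) :
      Rule ⟨insert (Fml.box (.union α β) φ) Γ, H, none, D, B, s, uevRestrict Γ f⟩
        [⟨{Fml.box α φ, Fml.box β φ} ∪ Γ, H, none, D, B, s, f⟩]
  /-- The rule `[;]`. -/
  | boxSeq (Γ H D B s f) (α β : Prg) (φ : Fml) (hΓ : Fml.box (.seq α β) φ ∉ Γ) :
      Rule ⟨insert (Fml.box (.seq α β) φ) Γ, H, none, D, B, s, uevRestrict Γ f⟩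
        [⟨insert (Fml.box α (.box β φ)) Γ, H, none, D, B, s, f⟩]
  /-- The rule `[*]`, when the principal formula is blocked. -/
  | boxStarBlocked (Γ H D B s f) (α : Prg) (φ : Fml) (hΓ : Fml.box (.star α) φ ∉ Γ)
      (hB : Fml.box (.star α) φ ∈ B) :
      Rule ⟨insert (Fml.box (.star α) φ) Γ, H, none, D, B, s, uevRestrict Γ f⟩
        [⟨Γ, H, none, D, insert (Fml.box (.star α) φ) B, s, f⟩]
  /-- The rule `[*]`, when the principal formula is not blocked. -/
  | boxStar (Γ H D B s f) (α : Prg) (φ : Fml) (hΓ : Fml.box (.star α) φ ∉ Γ)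
      (hB : Fml.box (.star α) φ ∉ B) :
      Rule ⟨insert (Fml.box (.star α) φ) Γ, H, none, D, B, s, uevRestrict Γ f⟩
        [⟨{φ, Fml.box α (.box (.star α) φ)} ∪ Γ, H, none, D,
          insert (Fml.box (.star α) φ) B, s, f⟩]
  /-- The rule `⟨;⟩`. -/
  | diaSeq (Γ H N D B s f) (α β : Prg) (φ : Fml) (hΓ : Fml.dia (.seq α β) φ ∉ Γ)
      (hN : N = none ∨ N = some (Fml.dia (.seq α β) φ)) :
      Rule ⟨insert (Fml.dia (.seq α β) φ) Γ, H, N, D, B, s,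
          uevInherit (.dia (.seq α β) φ) (.dia α (.dia β φ)) Γ f⟩
        [⟨insert (Fml.dia α (.dia β φ)) Γ, H, tst (.dia α (.dia β φ)),
          bl (.dia α (.dia β φ)) D, B, s, f⟩]
  /-- The rule `⟨?⟩`. -/
  | diaTest (Γ H N D B s f) (ψ φ : Fml) (hΓ : Fml.dia (.test ψ) φ ∉ Γ)
      (hN : N = none ∨ N = some (Fml.dia (.test ψ) φ)) :
      Rule ⟨insert (Fml.dia (.test ψ) φ) Γ, H, N, D, B, s,
          uevInherit (.dia (.test ψ) φ) φ Γ f⟩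
        [⟨{ψ, φ} ∪ Γ, H, tst φ, bl φ D, B, s, f⟩]
  /-- The rule `∨`. -/
  | disj (Γ H D B s₁ f₁ s₂ f₂) (φ₁ φ₂ : Fml) (hΓ : Fml.disj φ₁ φ₂ ∉ Γ) :
      Rule ⟨insert (Fml.disj φ₁ φ₂) Γ, H, none, D, B, betaStat s₁ s₂,
          betaUev s₁ s₂ (uevRestrict Γ f₁) (uevRestrict Γ f₂)⟩
        [⟨insert φ₁ Γ, H, none, D, B, s₁, f₁⟩, ⟨insert φ₂ Γ, H, none, D, B, s₂, f₂⟩]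
  /-- The rule `[?]`. -/
  | boxTest (Γ H D B s₁ f₁ s₂ f₂) (ψ φ : Fml) (hΓ : Fml.box (.test ψ) φ ∉ Γ) :
      Rule ⟨insert (Fml.box (.test ψ) φ) Γ, H, none, D, B, betaStat s₁ s₂,
          betaUev s₁ s₂ (uevRestrict Γ f₁) (uevRestrict Γ f₂)⟩
        [⟨insert ψ.compl Γ, H, none, D, B, s₁, f₁⟩, ⟨insert φ Γ, H, none, D, B, s₂, f₂⟩]
  /-- The rule `⟨∪⟩`. -/
  | diaUnion (Γ H N D B s₁ f₁ s₂ f₂) (α₁ α₂ : Prg) (φ : Fml)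
      (hΓ : Fml.dia (.union α₁ α₂) φ ∉ Γ)
      (hN : N = none ∨ N = some (Fml.dia (.union α₁ α₂) φ)) :
      Rule ⟨insert (Fml.dia (.union α₁ α₂) φ) Γ, H, N, D, B, betaStat s₁ s₂,
          betaUev s₁ s₂ (uevInherit (.dia (.union α₁ α₂) φ) (.dia α₁ φ) Γ f₁)
            (uevInherit (.dia (.union α₁ α₂) φ) (.dia α₂ φ) Γ f₂)⟩
        [⟨insert (Fml.dia α₁ φ) Γ, H, tst (.dia α₁ φ), bl (.dia α₁ φ) D, B, s₁, f₁⟩,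
         ⟨insert (Fml.dia α₂ φ) Γ, H, tst (.dia α₂ φ), bl (.dia α₂ φ) D, B, s₂, f₂⟩]
  /-- The rule `⟨*⟩₁`. -/
  | diaStar₁ (Γ H N D B s₁ f₁ s₂ f₂) (α : Prg) (φ : Fml)
      (hΓ : Fml.dia (.star α) φ ∉ Γ)
      (hN : N = none ∨ N = some (Fml.dia (.star α) φ))
      (hD : Fml.dia (.star α) φ ∉ D) :
      Rule ⟨insert (Fml.dia (.star α) φ) Γ, H, N, D, B, betaStat s₁ s₂,
          betaUev s₁ s₂ (uevInheritStar (.dia (.star α) φ) φ Γ f₁)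
            (uevInherit (.dia (.star α) φ) (.dia α (.dia (.star α) φ)) Γ f₂)⟩
        [⟨insert φ Γ, H, tst φ, bl φ (insert (.dia (.star α) φ) D), B, s₁, f₁⟩,
         ⟨insert (Fml.dia α (.dia (.star α) φ)) Γ, H, tst (.dia α (.dia (.star α) φ)),
          bl (.dia α (.dia (.star α) φ)) (insert (.dia (.star α) φ) D), B, s₂, f₂⟩]
  /-- The rule `⟨⟩`. The list `L` enumerates the unblocked diamond formulae. For a blocked
  `⟨a⟩φ`, the function `f a φ` is constant, its value being the position (counted from `1`) of the
  blocking entry in `HCr`. -/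
  | state (X H N D B) (L : List (ℕ × Fml)) (s : ℕ → Fml → Status) (f : ℕ → Fml → Uev)
      (hX : ∀ χ ∈ X, (∃ a φ, χ = Fml.dia (.atom a) φ) ∨ (∃ a φ, χ = Fml.box (.atom a) φ) ∨
        χ.IsLiteral)
      (hcons : ∀ p, ¬ (Fml.atom p ∈ X ∧ Fml.neg (.atom p) ∈ X))
      (hnodup : L.Nodup)
      (hL : ∀ a φ, (a, φ) ∈ L ↔ Fml.dia (.atom a) φ ∈ X ∧ ¬ Blocked X H a φ)
      (hf : ∀ a φ, Fml.dia (.atom a) φ ∈ X → Blocked X H a φ →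
        ∃ j : ℕ, H[j]? = some (φ, succSet X a φ) ∧ f a φ = fun _ _ => some j.succPNat) :
      Rule ⟨X, H, N, D, B, stateStat H L s f, stateUev X (stateStat H L s f) f⟩
        (L.map fun q => coreNode X H q.1 q.2 (s q.1 q.2) (f q.1 q.2))

/-! ### Tableaux -/

/-- An ordered, possibly infinite, tree of tableau nodes: `T p` is the node at position `p` (the
list of child numbers, counted from `0`, on the way down from the root `[]`), or `none` if there is
no such position. -/
abbrev Tree : Type := List ℕ → Option Node

/-- `T` is an expanded tableau for the formula set `Γ` and the given histories. Since some rule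
applies to every node that can occur in a tableau whose root formulae are in negation normal form,
and the rules `id`, `⟨*⟩₂` and `⟨⟩` may produce no children, a tableau is expanded if a rule has been
applied to each of its nodes. Finiteness is not required. -/
structure IsExpandedTableau (T : Tree) (Γ : Set Fml) (HCr : List (Fml × Set Fml))
    (Nx : Option Fml) (BD BB : Set Fml) : Prop where
  root : ∃ (stat : Status) (uev : Uev), T [] = some ⟨Γ, HCr, Nx, BD, BB, stat, uev⟩
  tree : ∀ (p : List ℕ) (i : ℕ), T p = none → T (p ++ [i]) = none
  rule : ∀ (p : List ℕ) (x : Node), T p = some x →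
    ∃ cs : List Node, Rule x cs ∧ ∀ i : ℕ, T (p ++ [i]) = cs[i]?

/-- `T` is an expanded tableau for the formula `φ`. -/
def IsExpandedTableauFor (T : Tree) (φ : Fml) : Prop :=
  IsExpandedTableau T {φ} [] none ∅ ∅

end PDL

namespace PDL

/-! ### Sizes -/

-- Let the root formula hold at a world of a model M. The argument walks M down the tableau and
-- shows that every node met on the way is open. Truth alone does not guide the walk, since it
-- allows a `⟨*⟩`-formula to be postponed forever, so diamonds are resolved along shortest paths:
-- `dist M w χ` is the least number of unfoldings that discharge the whole diamond prefix of χ from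
-- w, and every diamond rule has a satisfied child in which it drops. A node is `Guided` at w if its
-- formulae hold there and each member of D is strictly farther from its goal than the formula N in
-- focus. On such a node `id` contradicts truth, and `⟨*⟩₂` would make a distance smaller than
-- itself.
--
-- Openness alone is not inductive, because a state can be closed through u. `Ok` therefore adds:
-- whenever u(χ₁, ·) = j, some entry of H from position j on has its formula set satisfied at a
-- world where its formula is nearer to its goal than χ₁ is at w. At a state (`ok_state`) the child
-- is entered at a world minimising the distance among all worlds that satisfy its formula set. The
-- entry promised by the child then cannot be the one just appended, so it lies in H, j is at most
-- the length of H, and the closing condition fails.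
--
-- The tree may be infinite, so the induction (`ok_of_guided`, with step `ok_of_rule`) runs on a
-- lexicographic measure: pairs over the closure not yet in H, formulae of the closure not yet in B,
-- and the formula set under the multiset order of `Comp`. The first two are finite by `finClosed`.
-- The third is well-founded by `wellFounded_comp`, where the distance tames `⟨*⟩`; unfolding `[*]`
-- is charged to B.

mutual
/-- The size of a formula; negations are not counted. -/
def Fml.size : Fml → ℕ
  | .atom _ => 1
  | .neg φ => φ.size
  | .conj φ ψ => φ.size + ψ.size + 1
  | .disj φ ψ => φ.size + ψ.size + 1
  | .dia α φ => α.size + φ.size + 1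
  | .box α φ => α.size + φ.size + 1
/-- The size of a program. -/
def Prg.size : Prg → ℕ
  | .atom _ => 1
  | .seq α β => α.size + β.size + 1
  | .union α β => α.size + β.size + 1
  | .star α => α.size + 1
  | .test φ => φ.size + 1
end

mutual
theorem Fml.size_nnfAux : ∀ (b : Bool) (φ : Fml), (Fml.nnfAux b φ).size = φ.size
  | true, .atom p => by simp [Fml.nnfAux]
  | false, .atom p => by simp [Fml.nnfAux, Fml.size]
  | b, .neg φ => by simp [Fml.nnfAux, Fml.size, Fml.size_nnfAux (!b) φ]
  | true, .conj φ ψ => by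
    simp [Fml.nnfAux, Fml.size, Fml.size_nnfAux true φ, Fml.size_nnfAux true ψ]
  | false, .conj φ ψ => by
    simp [Fml.nnfAux, Fml.size, Fml.size_nnfAux false φ, Fml.size_nnfAux false ψ]
  | true, .disj φ ψ => by
    simp [Fml.nnfAux, Fml.size, Fml.size_nnfAux true φ, Fml.size_nnfAux true ψ]
  | false, .disj φ ψ => by
    simp [Fml.nnfAux, Fml.size, Fml.size_nnfAux false φ, Fml.size_nnfAux false ψ]
  | true, .dia α φ => by simp [Fml.nnfAux, Fml.size, Prg.size_nnf α, Fml.size_nnfAux true φ]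
  | false, .dia α φ => by simp [Fml.nnfAux, Fml.size, Prg.size_nnf α, Fml.size_nnfAux false φ]
  | true, .box α φ => by simp [Fml.nnfAux, Fml.size, Prg.size_nnf α, Fml.size_nnfAux true φ]
  | false, .box α φ => by simp [Fml.nnfAux, Fml.size, Prg.size_nnf α, Fml.size_nnfAux false φ]
theorem Prg.size_nnf : ∀ α : Prg, (Prg.nnf α).size = α.size
  | .atom a => by simp [Prg.nnf]
  | .seq α β => by simp [Prg.nnf, Prg.size, Prg.size_nnf α, Prg.size_nnf β]
  | .union α β => by simp [Prg.nnf, Prg.size, Prg.size_nnf α, Prg.size_nnf β]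
  | .star α => by simp [Prg.nnf, Prg.size, Prg.size_nnf α]
  | .test φ => by simp [Prg.nnf, Prg.size, Fml.size_nnfAux true φ]
end

/-- This makes `∼ψ` smaller than `[ψ?]φ`, so inductions on size pass through box tests. -/
theorem Fml.size_compl (φ : Fml) : φ.compl.size = φ.size := by
  simp [Fml.compl, Fml.nnf, Fml.size_nnfAux, Fml.size]

-- Semantics of negation normal forms

mutual
theorem sat_nnfAux (M : Model.{u}) : ∀ (b : Bool) (φ : Fml) (w : M.W),
    Sat M (Fml.nnfAux b φ) w ↔ (b = true ↔ Sat M φ w)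
  | true, .atom p, w => by simp [Fml.nnfAux]
  | false, .atom p, w => by simp [Fml.nnfAux, Sat]
  | b, .neg φ, w => by
    have := sat_nnfAux M (!b) φ w
    cases b <;> simp_all [Fml.nnfAux, Sat]
  | true, .conj φ ψ, w => by
    simp [Fml.nnfAux, Sat, sat_nnfAux M true φ, sat_nnfAux M true ψ]
  | false, .conj φ ψ, w => by
    simp [Fml.nnfAux, Sat, sat_nnfAux M false φ, sat_nnfAux M false ψ]; tauto
  | true, .disj φ ψ, w => by
    simp [Fml.nnfAux, Sat, sat_nnfAux M true φ, sat_nnfAux M true ψ]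
  | false, .disj φ ψ, w => by
    simp [Fml.nnfAux, Sat, sat_nnfAux M false φ, sat_nnfAux M false ψ]
  | true, .dia α φ, w => by
    simp [Fml.nnfAux, Sat, rel_nnf M α, sat_nnfAux M true φ]
  | false, .dia α φ, w => by
    simp [Fml.nnfAux, Sat, rel_nnf M α, sat_nnfAux M false φ]
  | true, .box α φ, w => by
    simp [Fml.nnfAux, Sat, rel_nnf M α, sat_nnfAux M true φ]
  | false, .box α φ, w => by
    simp [Fml.nnfAux, Sat, rel_nnf M α, sat_nnfAux M false φ]
theorem rel_nnf (M : Model.{u}) : ∀ (α : Prg) (w v : M.W),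
    Rel M (Prg.nnf α) w v ↔ Rel M α w v
  | .atom a, w, v => by simp [Prg.nnf]
  | .seq α β, w, v => by simp [Prg.nnf, Rel, rel_nnf M α, rel_nnf M β]
  | .union α β, w, v => by simp [Prg.nnf, Rel, rel_nnf M α, rel_nnf M β]
  | .star α, w, v => by simp [Prg.nnf, Rel, rel_nnf M α]
  | .test φ, w, v => by simp [Prg.nnf, Rel, sat_nnfAux M true φ]
end

theorem sat_compl (M : Model.{u}) (φ : Fml) (w : M.W) : Sat M φ.compl w ↔ ¬ Sat M φ w := by
  simp [Fml.compl, Fml.nnf, sat_nnfAux, Sat]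

/-! ### The Fischer–Ladner closure -/

/-- `Sub χ' χ`: the formula `χ'` may be introduced when a rule decomposes `χ`. -/
inductive Sub : Fml → Fml → Prop
  | conj_left (φ ψ) : Sub φ (.conj φ ψ)
  | conj_right (φ ψ) : Sub ψ (.conj φ ψ)
  | disj_left (φ ψ) : Sub φ (.disj φ ψ)
  | disj_right (φ ψ) : Sub ψ (.disj φ ψ)
  | dia_atom (a φ) : Sub φ (.dia (.atom a) φ)
  | dia_seq (α β φ) : Sub (.dia α (.dia β φ)) (.dia (.seq α β) φ)
  | dia_union_left (α β φ) : Sub (.dia α φ) (.dia (.union α β) φ)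
  | dia_union_right (α β φ) : Sub (.dia β φ) (.dia (.union α β) φ)
  | dia_star_left (α φ) : Sub φ (.dia (.star α) φ)
  | dia_star_right (α φ) : Sub (.dia α (.dia (.star α) φ)) (.dia (.star α) φ)
  | dia_test_left (ψ φ) : Sub ψ (.dia (.test ψ) φ)
  | dia_test_right (ψ φ) : Sub φ (.dia (.test ψ) φ)
  | box_atom (a φ) : Sub φ (.box (.atom a) φ)
  | box_seq (α β φ) : Sub (.box α (.box β φ)) (.box (.seq α β) φ)
  | box_union_left (α β φ) : Sub (.box α φ) (.box (.union α β) φ)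
  | box_union_right (α β φ) : Sub (.box β φ) (.box (.union α β) φ)
  | box_star_left (α φ) : Sub φ (.box (.star α) φ)
  | box_star_right (α φ) : Sub (.box α (.box (.star α) φ)) (.box (.star α) φ)
  | box_test_left (ψ φ) : Sub ψ.compl (.box (.test ψ) φ)
  | box_test_right (ψ φ) : Sub φ (.box (.test ψ) φ)

/-- `χ` lies in a finite set `S` of formulae such that everything that is introduced by
decomposing a formula of `S` lies in `S` or in `E`. -/
def FinClosed (E : Set Fml) (χ : Fml) : Prop :=
  ∃ S : Set Fml, S.Finite ∧ χ ∈ S ∧ ∀ ψ ∈ S, ∀ ψ', Sub ψ' ψ → ψ' ∈ S ∨ ψ' ∈ E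

theorem FinClosed.mono {E F : Set Fml} {χ : Fml} (h : FinClosed E χ) (hEF : E ⊆ F) :
    FinClosed F χ := by
  obtain ⟨S, h1, h2, h3⟩ := h
  exact ⟨S, h1, h2, fun ψ hψ ψ' h => (h3 ψ hψ ψ' h).imp id (@hEF _)⟩

/-- The finite sets for the members of K may refer back to χ and to all of K: these lie in the union
anyway, so only exits to E survive. This is what closes the loop through a starred program. -/
theorem FinClosed.of_sub {E K : Set Fml} {χ : Fml} (hK : K.Finite)
    (hsub : ∀ χ', Sub χ' χ → χ' ∈ K ∨ χ' ∈ E)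
    (h : ∀ χ' ∈ K, FinClosed (insert χ (K ∪ E)) χ') : FinClosed E χ := by
  choose! S h1 h2 h3 using h
  refine ⟨insert χ (⋃ k ∈ K, S k), (hK.biUnion h1).insert χ, Or.inl rfl, ?_⟩
  have key : ∀ k ∈ K, k ∈ insert χ (⋃ k ∈ K, S k) := fun k hk =>
    Or.inr (Set.mem_biUnion hk (h2 k hk))
  rintro ψ (rfl | hψ) ψ' hs
  · exact (hsub ψ' hs).imp (key ψ') id
  · obtain ⟨k, hk, hψk⟩ := Set.mem_iUnion₂.1 hψ
    rcases h3 k hk ψ hψk ψ' hs with h | rfl | h | h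
    · exact Or.inl (Or.inr (Set.mem_biUnion hk h))
    · exact Or.inl (Or.inl rfl)
    · exact Or.inl (key _ h)
    · exact Or.inr h

/-- With φ kept as an opaque exit, the recursion is on the program alone. For `α*` the exit of
`⟨α⟩⟨α*⟩φ` is `⟨α*⟩φ` itself, already present. The size hypothesis serves only the tests inside the
program. -/
theorem finClosed_dia : ∀ (α : Prg), (∀ ψ : Fml, ψ.size < α.size → FinClosed ∅ ψ) →
    ∀ φ, FinClosed {φ} (.dia α φ)
  | .atom a, _, φ => .of_sub (K := ∅) Set.finite_empty (by rintro _ ⟨⟩; simp) (by simp)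
  | .seq α β, h, φ => by
    refine .of_sub (K := {.dia α (.dia β φ), .dia β φ}) (Set.toFinite _) (by rintro _ ⟨⟩; simp) ?_
    rintro _ (rfl | rfl)
    · exact (finClosed_dia α (fun ψ hψ => h ψ (by simp only [Prg.size]; omega)) _).mono (by
        rintro _ rfl; simp)
    · exact (finClosed_dia β (fun ψ hψ => h ψ (by simp only [Prg.size]; omega)) _).mono (by
        rintro _ rfl; simp)
  | .union α β, h, φ => by
    refine .of_sub (K := {.dia α φ, .dia β φ}) (Set.toFinite _) (by rintro _ ⟨⟩ <;> simp) ?_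
    rintro _ (rfl | rfl)
    · exact (finClosed_dia α (fun ψ hψ => h ψ (by simp only [Prg.size]; omega)) _).mono (by
        rintro _ rfl; simp)
    · exact (finClosed_dia β (fun ψ hψ => h ψ (by simp only [Prg.size]; omega)) _).mono (by
        rintro _ rfl; simp)
  | .star α, h, φ => by
    refine .of_sub (K := {.dia α (.dia (.star α) φ)}) (Set.toFinite _)
      (by rintro _ ⟨⟩ <;> simp) ?_
    rintro _ rfl
    exact (finClosed_dia α (fun ψ hψ => h ψ (by simp only [Prg.size]; omega)) _).mono (by
      rintro _ rfl; simp)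
  | .test ψ, h, φ => by
    refine .of_sub (K := {ψ}) (Set.toFinite _) (by rintro _ ⟨⟩ <;> simp) ?_
    rintro χ hχ
    rw [Set.mem_singleton_iff.1 hχ]
    exact (h ψ (by simp [Prg.size])).mono (by simp)

theorem finClosed_box : ∀ (α : Prg), (∀ ψ : Fml, ψ.size < α.size → FinClosed ∅ ψ) →
    ∀ φ, FinClosed {φ} (.box α φ)
  | .atom a, _, φ => .of_sub (K := ∅) Set.finite_empty (by rintro _ ⟨⟩; simp) (by simp)
  | .seq α β, h, φ => by
    refine .of_sub (K := {.box α (.box β φ), .box β φ}) (Set.toFinite _) (by rintro _ ⟨⟩; simp) ?_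
    rintro _ (rfl | rfl)
    · exact (finClosed_box α (fun ψ hψ => h ψ (by simp only [Prg.size]; omega)) _).mono (by
        rintro _ rfl; simp)
    · exact (finClosed_box β (fun ψ hψ => h ψ (by simp only [Prg.size]; omega)) _).mono (by
        rintro _ rfl; simp)
  | .union α β, h, φ => by
    refine .of_sub (K := {.box α φ, .box β φ}) (Set.toFinite _) (by rintro _ ⟨⟩ <;> simp) ?_
    rintro _ (rfl | rfl)
    · exact (finClosed_box α (fun ψ hψ => h ψ (by simp only [Prg.size]; omega)) _).mono (by
        rintro _ rfl; simp)
    · exact (finClosed_box β (fun ψ hψ => h ψ (by simp only [Prg.size]; omega)) _).mono (by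
        rintro _ rfl; simp)
  | .star α, h, φ => by
    refine .of_sub (K := {.box α (.box (.star α) φ)}) (Set.toFinite _)
      (by rintro _ ⟨⟩ <;> simp) ?_
    rintro _ rfl
    exact (finClosed_box α (fun ψ hψ => h ψ (by simp only [Prg.size]; omega)) _).mono (by
      rintro _ rfl; simp)
  | .test ψ, h, φ => by
    refine .of_sub (K := {ψ.compl}) (Set.toFinite _) (by rintro _ ⟨⟩ <;> simp) ?_
    rintro _ rfl
    exact (h ψ.compl (by simp [Prg.size, Fml.size_compl])).mono (by simp)

theorem finClosed (φ : Fml) : FinClosed ∅ φ := by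
  induction hn : φ.size using Nat.strong_induction_on generalizing φ with
  | _ n ih =>
    subst hn
    have two : ∀ χ φ ψ : Fml, (∀ χ', Sub χ' χ → χ' = φ ∨ χ' = ψ) → φ.size < χ.size →
        FinClosed (insert χ ({φ, ψ} ∪ ∅)) ψ → (∀ k, k < χ.size → ∀ φ : Fml, φ.size = k → FinClosed ∅ φ) →
        FinClosed ∅ χ := by
      intro χ φ ψ h1 h2 h3 ih
      refine .of_sub (K := {φ, ψ}) (Set.toFinite _) (fun χ' h => Or.inl (h1 χ' h)) ?_
      rintro _ (rfl | rfl)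
      · exact (ih _ h2 _ rfl).mono (by simp)
      · exact h3
    match φ, ih with
    | .atom p, _ => exact .of_sub (K := ∅) Set.finite_empty (by rintro _ ⟨⟩) (by simp)
    | .neg φ, _ => exact .of_sub (K := ∅) Set.finite_empty (by rintro _ ⟨⟩) (by simp)
    | .conj φ ψ, ih =>
      exact two _ φ ψ (by rintro _ ⟨⟩ <;> simp) (by simp only [Fml.size]; omega)
        ((ih _ (by simp only [Fml.size]; omega) ψ rfl).mono (by simp)) ih
    | .disj φ ψ, ih =>
      exact two _ φ ψ (by rintro _ ⟨⟩ <;> simp) (by simp only [Fml.size]; omega)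
        ((ih _ (by simp only [Fml.size]; omega) ψ rfl).mono (by simp)) ih
    | .dia α φ, ih =>
      obtain ⟨S, h1, h2, h3⟩ := finClosed_dia α
        (fun ψ hψ => ih _ (by simp only [Fml.size]; omega) ψ rfl) φ
      obtain ⟨S', h1', h2', h3'⟩ := ih φ.size (by simp only [Fml.size]; omega) φ rfl
      refine ⟨S ∪ S', h1.union h1', Or.inl h2, ?_⟩
      rintro ψ (hψ | hψ) ψ' hs
      · rcases h3 ψ hψ ψ' hs with h | rfl
        exacts [Or.inl (Or.inl h), Or.inl (Or.inr h2')]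
      · exact (h3' ψ hψ ψ' hs).imp Or.inr id
    | .box α φ, ih =>
      obtain ⟨S, h1, h2, h3⟩ := finClosed_box α
        (fun ψ hψ => ih _ (by simp only [Fml.size]; omega) ψ rfl) φ
      obtain ⟨S', h1', h2', h3'⟩ := ih φ.size (by simp only [Fml.size]; omega) φ rfl
      refine ⟨S ∪ S', h1.union h1', Or.inl h2, ?_⟩
      rintro ψ (hψ | hψ) ψ' hs
      · rcases h3 ψ hψ ψ' hs with h | rfl
        exacts [Or.inl (Or.inl h), Or.inl (Or.inr h2')]
      · exact (h3' ψ hψ ψ' hs).imp Or.inr id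

/-! ### The length of a chain of diamonds -/

/-- `Reach M n w χ`: the diamonds in front of `χ` can be resolved, starting from the world `w`,
in `n` steps, and what remains holds at the world that is reached. -/
inductive Reach (M : Model.{u}) : ℕ → M.W → Fml → Prop
  | base {w χ} (hχ : ∀ α φ, χ ≠ .dia α φ) (h : Sat M χ w) : Reach M 0 w χ
  | atom {n w v a φ} (hR : M.R a w v) (h : Reach M n v φ) : Reach M (n + 1) w (.dia (.atom a) φ)
  | seq {n w α β φ} (h : Reach M n w (.dia α (.dia β φ))) : Reach M (n + 1) w (.dia (.seq α β) φ)
  | union_left {n w α β φ} (h : Reach M n w (.dia α φ)) : Reach M (n + 1) w (.dia (.union α β) φ)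
  | union_right {n w α β φ} (h : Reach M n w (.dia β φ)) : Reach M (n + 1) w (.dia (.union α β) φ)
  | star_left {n w α φ} (h : Reach M n w φ) : Reach M (n + 1) w (.dia (.star α) φ)
  | star_right {n w α φ} (h : Reach M n w (.dia α (.dia (.star α) φ))) :
      Reach M (n + 1) w (.dia (.star α) φ)
  | test {n w ψ φ} (hψ : Sat M ψ w) (h : Reach M n w φ) : Reach M (n + 1) w (.dia (.test ψ) φ)

variable {M : Model.{u}}

theorem Reach.sat {n : ℕ} {w : M.W} {χ : Fml} (h : Reach M n w χ) : Sat M χ w := by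
  induction h with
  | base _ h => exact h
  | atom hR _ ih => exact ⟨_, hR, ih⟩
  | seq _ ih =>
    obtain ⟨v, h1, u, h2, h3⟩ := ih
    exact ⟨u, ⟨v, h1, h2⟩, h3⟩
  | union_left _ ih =>
    obtain ⟨v, h1, h2⟩ := ih
    exact ⟨v, Or.inl h1, h2⟩
  | union_right _ ih =>
    obtain ⟨v, h1, h2⟩ := ih
    exact ⟨v, Or.inr h1, h2⟩
  | star_left _ ih => exact ⟨_, .refl, ih⟩
  | star_right _ ih =>
    obtain ⟨v, h1, u, h2, h3⟩ := ih
    exact ⟨u, .head h1 h2, h3⟩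
  | test hψ _ ih => exact ⟨_, ⟨rfl, hψ⟩, ih⟩

/-- The continuation φ is arbitrary, so sequences compose; for a star the resolution is built
backwards from the end of the path, one `⟨α⟩⟨α*⟩φ` at a time. -/
theorem exists_reach_dia : ∀ (α : Prg) (φ : Fml) (w v : M.W), Rel M α w v →
    (∃ n, Reach M n v φ) → ∃ n, Reach M n w (.dia α φ)
  | .atom _, _, _, _, h, ⟨_, hn⟩ => ⟨_, .atom h hn⟩
  | .seq α β, φ, w, v, ⟨t, h1, h2⟩, hn =>
    have ⟨_, h⟩ := exists_reach_dia α _ w t h1 (exists_reach_dia β φ t v h2 hn)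
    ⟨_, .seq h⟩
  | .union α _, φ, w, v, .inl h, hn =>
    have ⟨_, h⟩ := exists_reach_dia α φ w v h hn
    ⟨_, .union_left h⟩
  | .union _ β, φ, w, v, .inr h, hn =>
    have ⟨_, h⟩ := exists_reach_dia β φ w v h hn
    ⟨_, .union_right h⟩
  | .star α, φ, w, v, h, ⟨n, hn⟩ => by
    have ih := exists_reach_dia α
    induction (show Relation.ReflTransGen (fun s t => Rel M α s t) w v from h)
      using Relation.ReflTransGen.head_induction_on with
    | refl => exact ⟨_, .star_left hn⟩
    | head h1 h2 ih2 =>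
      obtain ⟨_, h⟩ := ih _ _ _ h1 (ih2 h2)
      exact ⟨_, .star_right h⟩
  | .test _, _, _, _, ⟨rfl, hψ⟩, ⟨_, hn⟩ => ⟨_, .test hψ hn⟩

theorem exists_reach : ∀ (χ : Fml) (w : M.W), Sat M χ w → ∃ n, Reach M n w χ
  | .atom _, _, h => ⟨0, .base (by simp) h⟩
  | .neg _, _, h => ⟨0, .base (by simp) h⟩
  | .conj _ _, _, h => ⟨0, .base (by simp) h⟩
  | .disj _ _, _, h => ⟨0, .base (by simp) h⟩
  | .box _ _, _, h => ⟨0, .base (by simp) h⟩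
  | .dia α φ, w, ⟨v, h1, h2⟩ => exists_reach_dia α φ w v h1 (exists_reach φ v h2)

variable (M) in
/-- The least number of steps in which the diamonds in front of `χ` can be resolved at `w`. -/
noncomputable def dist (w : M.W) (χ : Fml) : ℕ := sInf {n | Reach M n w χ}

theorem reach_dist {χ : Fml} {w : M.W} (h : Sat M χ w) : Reach M (dist M w χ) w χ :=
  Nat.sInf_mem (exists_reach χ w h)

/-- The bound `n + 1` is what inverting a diamond constructor of `Reach` leaves on the other side,
so each unfolding yields a strict decrease. -/
theorem Reach.dist_lt {n : ℕ} {χ : Fml} {w : M.W} (h : Reach M n w χ) : dist M w χ < n + 1 :=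
  Nat.lt_succ_of_le (Nat.sInf_le h)

variable (M) in
/-- `Good M w δ π`: the formula `δ` holds at `w` and is closer to its goal than `π`. -/
def Good (w : M.W) (δ π : Fml) : Prop := Sat M δ w ∧ dist M w δ < dist M w π

-- Decrease of the distance along a shortest resolution

theorem good_atom {a : ℕ} {φ : Fml} {w : M.W} (h : Sat M (.dia (.atom a) φ) w) :
    ∃ v, M.R a w v ∧ Sat M φ v ∧ dist M v φ < dist M w (.dia (.atom a) φ) := by
  have := reach_dist h
  -- With the minimum replaced by a variable, inversion can identify it with `n + 1` for the length
  -- n of the remaining resolution.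
  generalize dist M w (.dia (.atom a) φ) = n at this
  cases this with
  | base hχ _ => exact absurd rfl (hχ _ _)
  | atom hR h => exact ⟨_, hR, h.sat, h.dist_lt⟩

theorem good_seq {α β : Prg} {φ : Fml} {w : M.W} (h : Sat M (.dia (.seq α β) φ) w) :
    Good M w (.dia α (.dia β φ)) (.dia (.seq α β) φ) := by
  have := reach_dist h
  unfold Good
  generalize dist M w (.dia (.seq α β) φ) = n at this
  cases this with
  | base hχ _ => exact absurd rfl (hχ _ _)
  | seq h => exact ⟨h.sat, h.dist_lt⟩

theorem good_test {ψ φ : Fml} {w : M.W} (h : Sat M (.dia (.test ψ) φ) w) :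
    Sat M ψ w ∧ Good M w φ (.dia (.test ψ) φ) := by
  have := reach_dist h
  unfold Good
  generalize dist M w (.dia (.test ψ) φ) = n at this
  cases this with
  | base hχ _ => exact absurd rfl (hχ _ _)
  | test hψ h => exact ⟨hψ, h.sat, h.dist_lt⟩

theorem good_union {α β : Prg} {φ : Fml} {w : M.W} (h : Sat M (.dia (.union α β) φ) w) :
    Good M w (.dia α φ) (.dia (.union α β) φ) ∨ Good M w (.dia β φ) (.dia (.union α β) φ) := by
  have := reach_dist h
  unfold Good
  generalize dist M w (.dia (.union α β) φ) = n at this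
  cases this with
  | base hχ _ => exact absurd rfl (hχ _ _)
  | union_left h => exact Or.inl ⟨h.sat, h.dist_lt⟩
  | union_right h => exact Or.inr ⟨h.sat, h.dist_lt⟩

theorem good_star {α : Prg} {φ : Fml} {w : M.W} (h : Sat M (.dia (.star α) φ) w) :
    Good M w φ (.dia (.star α) φ) ∨
      Good M w (.dia α (.dia (.star α) φ)) (.dia (.star α) φ) := by
  have := reach_dist h
  unfold Good
  generalize dist M w (.dia (.star α) φ) = n at this
  cases this with
  | base hχ _ => exact absurd rfl (hχ _ _)
  | star_left h => exact Or.inl ⟨h.sat, h.dist_lt⟩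
  | star_right h => exact Or.inr ⟨h.sat, h.dist_lt⟩

/-! ### Termination of the local rules along a guided path -/

variable (M) in
/-- `Comp M w χ' χ`: the formula `χ'` may be introduced when `χ` is decomposed at the world `w`
by a rule other than `[*]` and `⟨⟩`, where diamonds have to come closer to their goals. -/
inductive Comp (w : M.W) : Fml → Fml → Prop
  | conj_left (φ ψ) : Comp w φ (.conj φ ψ)
  | conj_right (φ ψ) : Comp w ψ (.conj φ ψ)
  | disj_left (φ ψ) : Comp w φ (.disj φ ψ)
  | disj_right (φ ψ) : Comp w ψ (.disj φ ψ)
  | dia_seq (α β φ) (h : dist M w (.dia α (.dia β φ)) < dist M w (.dia (.seq α β) φ)) :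
      Comp w (.dia α (.dia β φ)) (.dia (.seq α β) φ)
  | dia_union_left (α β φ) (h : dist M w (.dia α φ) < dist M w (.dia (.union α β) φ)) :
      Comp w (.dia α φ) (.dia (.union α β) φ)
  | dia_union_right (α β φ) (h : dist M w (.dia β φ) < dist M w (.dia (.union α β) φ)) :
      Comp w (.dia β φ) (.dia (.union α β) φ)
  | dia_star_left (α φ) (h : dist M w φ < dist M w (.dia (.star α) φ)) :
      Comp w φ (.dia (.star α) φ)
  | dia_star_right (α φ)
      (h : dist M w (.dia α (.dia (.star α) φ)) < dist M w (.dia (.star α) φ)) :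
      Comp w (.dia α (.dia (.star α) φ)) (.dia (.star α) φ)
  | dia_test_left (ψ φ) : Comp w ψ (.dia (.test ψ) φ)
  | dia_test_right (ψ φ) (h : dist M w φ < dist M w (.dia (.test ψ) φ)) :
      Comp w φ (.dia (.test ψ) φ)
  | box_seq (α β φ) : Comp w (.box α (.box β φ)) (.box (.seq α β) φ)
  | box_union_left (α β φ) : Comp w (.box α φ) (.box (.union α β) φ)
  | box_union_right (α β φ) : Comp w (.box β φ) (.box (.union α β) φ)
  | box_test_left (ψ φ) : Comp w ψ.compl (.box (.test ψ) φ)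
  | box_test_right (ψ φ) : Comp w φ (.box (.test ψ) φ)

/-- The formulae `⟨α₁⟩ … ⟨αₖ⟩χ` where the sizes of the programs are bounded by `n`. -/
inductive Chain (n : ℕ) (χ : Fml) : Fml → Prop
  | nil : Chain n χ χ
  | cons {α φ} (hα : α.size ≤ n) (h : Chain n χ φ) : Chain n χ (.dia α φ)

/-- Every component of a diamond has smaller distance, except the formula of a test, which is
smaller than a program of the chain. Syntactic size would not do, as `⟨α*⟩φ` grows when unfolded;
program sizes in the chain do stay bounded. -/
theorem acc_comp_of_chain {w : M.W} {n : ℕ} {χ : Fml}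
    (hn : ∀ ψ : Fml, ψ.size < n → Acc (Comp M w) ψ) (hχ : Acc (Comp M w) χ) (φ : Fml)
    (h : Chain n χ φ) : Acc (Comp M w) φ := by
  induction hd : dist M w φ using Nat.strong_induction_on generalizing φ with
  | _ d ih =>
    subst hd
    cases h with
    | nil => exact hχ
    | cons hα hc =>
      refine ⟨_, fun φ' hφ' => ?_⟩
      cases hφ' with
      | dia_seq α β φ h =>
        simp only [Prg.size] at hα
        exact ih _ h _ (.cons (by omega) (.cons (by omega) hc)) rfl
      | dia_union_left α β φ h =>
        simp only [Prg.size] at hα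
        exact ih _ h _ (.cons (by omega) hc) rfl
      | dia_union_right α β φ h =>
        simp only [Prg.size] at hα
        exact ih _ h _ (.cons (by omega) hc) rfl
      | dia_star_left α φ h => exact ih _ h _ hc rfl
      | dia_star_right α φ h =>
        exact ih _ h _ (.cons (by simp only [Prg.size] at hα; omega) (.cons hα hc)) rfl
      | dia_test_left ψ φ =>
        simp only [Prg.size] at hα
        exact hn _ (by omega)
      | dia_test_right ψ φ h => exact ih _ h _ hc rfl

/-- `Comp` does not unfold `[α*]φ`, so starred boxes are minimal and recursion on the program
suffices. -/
theorem acc_comp_box {w : M.W} : ∀ (α : Prg),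
    (∀ ψ : Fml, ψ.size < α.size → Acc (Comp M w) ψ) → ∀ φ, Acc (Comp M w) φ →
    Acc (Comp M w) (.box α φ)
  | .atom a, _, φ, _ => ⟨_, by rintro _ ⟨⟩⟩
  | .star α, _, φ, _ => ⟨_, by rintro _ ⟨⟩⟩
  | .seq α β, h, φ, hφ => ⟨_, by
    rintro _ ⟨⟩
    simp only [Prg.size] at h
    exact acc_comp_box α (fun ψ hψ => h ψ (by omega)) _
      (acc_comp_box β (fun ψ hψ => h ψ (by omega)) _ hφ)⟩
  | .union α β, h, φ, hφ => ⟨_, by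
    simp only [Prg.size] at h
    rintro _ ⟨⟩
    exacts [acc_comp_box α (fun ψ hψ => h ψ (by omega)) _ hφ,
      acc_comp_box β (fun ψ hψ => h ψ (by omega)) _ hφ]⟩
  | .test ψ, h, φ, hφ => ⟨_, by
    rintro _ ⟨⟩
    exacts [h _ (by simp [Prg.size, Fml.size_compl]), hφ]⟩

theorem wellFounded_comp (w : M.W) : WellFounded (Comp M w) := by
  refine ⟨fun χ => ?_⟩
  induction hn : χ.size using Nat.strong_induction_on generalizing χ with
  | _ n ih =>
    subst hn
    match χ, ih with
    | .atom p, _ => exact ⟨_, by rintro _ ⟨⟩⟩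
    | .neg φ, _ => exact ⟨_, by rintro _ ⟨⟩⟩
    | .conj φ ψ, ih =>
      refine ⟨_, ?_⟩
      rintro _ ⟨⟩
      exacts [ih _ (by simp only [Fml.size]; omega) _ rfl,
        ih _ (by simp only [Fml.size]; omega) _ rfl]
    | .disj φ ψ, ih =>
      refine ⟨_, ?_⟩
      rintro _ ⟨⟩
      exacts [ih _ (by simp only [Fml.size]; omega) _ rfl,
        ih _ (by simp only [Fml.size]; omega) _ rfl]
    | .dia α φ, ih =>
      exact acc_comp_of_chain (n := α.size)
        (fun ψ hψ => ih _ (by simp only [Fml.size]; omega) ψ rfl)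
        (ih _ (by simp only [Fml.size]; omega) φ rfl) _ (.cons le_rfl .nil)
    | .box α φ, ih =>
      exact acc_comp_box α (fun ψ hψ => ih _ (by simp only [Fml.size]; omega) ψ rfl) φ
        (ih _ (by simp only [Fml.size]; omega) φ rfl)

variable (M) in
/-- The order on sets of formulae in which a formula is replaced by its components. -/
def SetLt (w : M.W) (S' S : Finset Fml) : Prop := Relation.CutExpand (Comp M w) S'.val S.val

theorem wellFounded_setLt (w : M.W) : WellFounded (SetLt M w) :=
  have : Std.Irrefl (Comp M w) := ⟨fun _ h => (wellFounded_comp w).asymmetric _ _ h h⟩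
  InvImage.wf _ (wellFounded_comp w).cutExpand

open Classical in
theorem setLt_of_comp {w : M.W} {Γ K : Finset Fml} {π : Fml} (hπ : π ∉ Γ)
    (hK : ∀ κ ∈ K, Comp M w κ π) : SetLt M w (K ∪ Γ) (insert π Γ) := by
  -- Sets merge duplicates, so only the part of K outside Γ is really added as a multiset.
  refine ⟨(K \ Γ).val, π, fun κ hκ => hK κ (Finset.mem_sdiff.1 hκ).1, ?_⟩
  rw [Finset.insert_val_of_notMem hπ, ← Finset.sdiff_union_self_eq_union,
    ← Finset.disjUnion_eq_union _ _ Finset.sdiff_disjoint, Finset.disjUnion_val]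
  simp only [← Multiset.singleton_add]
  ac_rfl

/-! ### The invariant -/

variable (M) in
/-- If `o` is a number `j`, then some entry of `H` from position `j` on is satisfied at a world at
which its first formula has distance less than `n` to its goal. -/
def UevOk (H : List (Fml × Set Fml)) (n : ℕ) (o : Option ℕ+) : Prop :=
  ∀ j, o = some j → ∃ i : ℕ, (j : ℕ) ≤ i + 1 ∧ ∃ e, H[i]? = some e ∧
    ∃ v : M.W, (∀ ψ ∈ e.2, Sat M ψ v) ∧ dist M v e.1 < n

theorem uevOk_none (H : List (Fml × Set Fml)) (n : ℕ) : UevOk M H n none := by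
  intro j hj
  cases hj

theorem UevOk.mono {H : List (Fml × Set Fml)} {m n : ℕ} {o : Option ℕ+} (h : UevOk M H m o)
    (hmn : m ≤ n) : UevOk M H n o := fun j hj =>
  have ⟨i, h1, e, h2, v, h3, h4⟩ := h j hj
  ⟨i, h1, e, h2, v, h3, h4.trans_le hmn⟩

variable (M) in
/-- The node `x` is open and its function `uev` only refers to entries of `HCr` that are closer
to their goals. -/
def Ok (x : Node) (w : M.W) : Prop :=
  x.stat = Status.isOpen ∧ ∀ χ₁ ∈ x.fmls, ∀ χ₂, UevOk M x.HCr (dist M w χ₁) (x.uev χ₁ χ₂)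

variable (M) in
/-- The formulae in `D` are further from their goals than the formula `N`. -/
def ChainOk (N : Option Fml) (D : Set Fml) (w : M.W) : Prop :=
  ∀ ε ∈ D, ∃ π, N = some π ∧ dist M w π < dist M w ε

variable (M) in
/-- The formulae of `x` hold at `w`, and the formulae in `BD` have been resolved along a
shortest path. -/
def Guided (x : Node) (w : M.W) : Prop :=
  (∀ ψ ∈ x.fmls, Sat M ψ w) ∧ ChainOk M x.Nx x.BD w

theorem chainOk_empty (N : Option Fml) (w : M.W) : ChainOk M N ∅ w := fun _ h => h.elim

/-- If δ is reducible it becomes the new focus and the inequalities extend by transitivity;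
otherwise D is emptied. -/
theorem ChainOk.child {N : Option Fml} {D S : Set Fml} {w : M.W} {π δ : Fml}
    (h : ChainOk M N D w) (hN : N = none ∨ N = some π) (hδ : dist M w δ < dist M w π)
    (hS : S ⊆ insert π D) : ChainOk M (tst δ) (bl δ S) w := by
  unfold tst bl
  split_ifs
  · intro ε hε
    refine ⟨δ, rfl, ?_⟩
    rcases hS hε with rfl | hε
    · exact hδ
    -- As D has a member, the invariant rules out `N = ⊥`, so the old focus is π.
    · obtain ⟨π', rfl, h2⟩ := h ε hε
      obtain rfl : π' = π := by simpa using hN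
      exact hδ.trans h2
  · exact chainOk_empty _ _

-- Propagation of u through the local rules

theorem uevOk_restrict {H : List (Fml × Set Fml)} {Γ : Set Fml} {f : Uev} {w : M.W}
    (h : ∀ χ₁ ∈ Γ, ∀ χ₂, UevOk M H (dist M w χ₁) (f χ₁ χ₂)) (χ₁ χ₂ : Fml) :
    UevOk M H (dist M w χ₁) (uevRestrict Γ f χ₁ χ₂) := by
  unfold uevRestrict
  split_ifs with h1
  · exact h _ h1 _
  · exact uevOk_none _ _

theorem uevOk_inherit {H : List (Fml × Set Fml)} {Γ : Set Fml} {f : Uev} {w : M.W} {π δ : Fml}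
    (hΓ : ∀ χ₁ ∈ Γ, ∀ χ₂, UevOk M H (dist M w χ₁) (f χ₁ χ₂))
    (hδ : ∀ χ₂, UevOk M H (dist M w δ) (f δ χ₂)) (hlt : dist M w δ < dist M w π)
    (χ₁ χ₂ : Fml) : UevOk M H (dist M w χ₁) (uevInherit π δ Γ f χ₁ χ₂) := by
  unfold uevInherit
  split_ifs with h1 h2
  · subst h1
    exact (hδ _).mono hlt.le
  · exact hΓ _ h2 _
  · exact uevOk_none _ _

/-- An undefined value carries no obligation, so erasing the entry at (π, π) is harmless. -/
theorem uevOk_inheritStar {H : List (Fml × Set Fml)} {Γ : Set Fml} {f : Uev} {w : M.W}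
    {π δ : Fml} (hΓ : ∀ χ₁ ∈ Γ, ∀ χ₂, UevOk M H (dist M w χ₁) (f χ₁ χ₂))
    (hδ : ∀ χ₂, UevOk M H (dist M w δ) (f δ χ₂)) (hlt : dist M w δ < dist M w π)
    (χ₁ χ₂ : Fml) : UevOk M H (dist M w χ₁) (uevInheritStar π δ Γ f χ₁ χ₂) := by
  unfold uevInheritStar
  split_ifs
  · exact uevOk_none _ _
  · exact uevOk_inherit hΓ hδ hlt _ _

/-- `UevOk` only bounds the position from below by j, so lowering j weakens it; one good child is
enough. -/
theorem uevOk_min_left {H : List (Fml × Set Fml)} {n : ℕ} {f g : Uev} {χ₁ χ₂ : Fml}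
    (h : UevOk M H n (f χ₁ χ₂)) : UevOk M H n (uevMin f g χ₁ χ₂) := by
  intro j hj
  unfold uevMin at hj
  split at hj
  · next a b h1 h2 =>
    obtain ⟨i, h3, h4⟩ := h a h1
    cases hj
    exact ⟨i, le_trans (PNat.coe_le_coe _ _ |>.2 (min_le_left a b)) h3, h4⟩
  · cases hj

theorem uevMin_comm (f g : Uev) : uevMin f g = uevMin g f := by
  funext χ₁ χ₂
  unfold uevMin
  cases f χ₁ χ₂ <;> cases g χ₁ χ₂ <;> simp [min_comm]

theorem betaStat_comm (s t : Status) : betaStat s t = betaStat t s := by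
  cases s <;> cases t <;> rfl

theorem betaUev_comm (s t : Status) (f g : Uev) : betaUev s t f g = betaUev t s g f := by
  cases s <;> cases t <;> simp [betaUev, uevMin_comm f g]

/-- One open child suffices for a node with two children. -/
theorem ok_beta_left {Γ : Set Fml} {H : List (Fml × Set Fml)} {N : Option Fml} {D B : Set Fml}
    {s₁ s₂ : Status} {f₁ f₂ : Uev} {w : M.W} (hs : s₁ = Status.isOpen)
    (h : ∀ χ₁ χ₂, UevOk M H (dist M w χ₁) (f₁ χ₁ χ₂)) :
    Ok M ⟨Γ, H, N, D, B, betaStat s₁ s₂, betaUev s₁ s₂ f₁ f₂⟩ w := by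
  subst hs
  refine ⟨by cases s₂ <;> rfl, fun χ₁ _ χ₂ => ?_⟩
  cases s₂
  exacts [h _ _, uevOk_min_left (h _ _), h _ _]

theorem ok_beta_right {Γ : Set Fml} {H : List (Fml × Set Fml)} {N : Option Fml} {D B : Set Fml}
    {s₁ s₂ : Status} {f₁ f₂ : Uev} {w : M.W} (hs : s₂ = Status.isOpen)
    (h : ∀ χ₁ χ₂, UevOk M H (dist M w χ₁) (f₂ χ₁ χ₂)) :
    Ok M ⟨Γ, H, N, D, B, betaStat s₁ s₂, betaUev s₁ s₂ f₁ f₂⟩ w := by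
  rw [betaStat_comm, betaUev_comm]
  exact ok_beta_left hs h

/-! ### The existential branching rule -/

/-- If the children of a state are open along guided paths, then so is the state. -/
theorem ok_state {X : Set Fml} {H : List (Fml × Set Fml)} {N : Option Fml} {D B : Set Fml}
    {L : List (ℕ × Fml)} {s : ℕ → Fml → Status} {f : ℕ → Fml → Uev} {w : M.W}
    (hL : ∀ a φ, (a, φ) ∈ L ↔ Fml.dia (.atom a) φ ∈ X ∧ ¬ Blocked X H a φ)
    (hf : ∀ a φ, Fml.dia (.atom a) φ ∈ X → Blocked X H a φ →
      ∃ j : ℕ, H[j]? = some (φ, succSet X a φ) ∧ f a φ = fun _ _ => some j.succPNat)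
    (hsat : ∀ ψ ∈ X, Sat M ψ w)
    (ih : ∀ a φ, (a, φ) ∈ L → ∀ v, (∀ ψ ∈ succSet X a φ, Sat M ψ v) →
      Ok M (coreNode X H a φ (s a φ) (f a φ)) v) :
    Ok M ⟨X, H, N, D, B, stateStat H L s f, stateUev X (stateStat H L s f) f⟩ w := by
  have hsucc : ∀ a φ, Fml.dia (.atom a) φ ∈ X → ∃ v, (∀ ψ ∈ succSet X a φ, Sat M ψ v) ∧
      dist M v φ < dist M w (.dia (.atom a) φ) := by
    intro a φ h
    obtain ⟨v, h1, h2, h3⟩ := good_atom (hsat _ h)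
    refine ⟨v, ?_, h3⟩
    rintro ψ (rfl | hψ)
    exacts [h2, hsat _ hψ v h1]
  have hopen : ∀ a φ, (a, φ) ∈ L → s a φ = Status.isOpen ∧
      ∀ χ₂, UevOk M H (dist M w (.dia (.atom a) φ)) (f a φ φ χ₂) := by
    intro a φ h
    obtain ⟨v, hv, hlt⟩ := hsucc a φ ((hL a φ).1 h).1
    -- The minimum is over all worlds satisfying the child's set, not only successors of w: the
    -- world supplied by the child's invariant may be anywhere in M.
    have hne : ({v | ∀ ψ ∈ succSet X a φ, Sat M ψ v} : Set M.W).Nonempty := ⟨v, hv⟩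
    obtain ⟨v₀, hv₀, hmin⟩ := WellFounded.has_min
      (InvImage.wf (fun v => dist M v φ) Nat.lt_wfRel.wf) _ hne
    obtain ⟨h1, h2⟩ := ih a φ h v₀ hv₀
    refine ⟨h1, fun χ₂ j hj => ?_⟩
    obtain ⟨i, h3, e, h4, v', h5, h6⟩ := h2 φ (Or.inl rfl) χ₂ j hj
    refine ⟨i, h3, e, ?_, v', h5, ?_⟩
    · simp only [coreNode] at h4
      rcases List.mem_append.1 (List.mem_of_getElem? h4) with he | he
      · by_cases hi : i < H.length
        · rwa [List.getElem?_append_left hi] at h4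
        · rw [List.getElem?_append_right (by omega)] at h4
          obtain rfl : (φ, succSet X a φ) = e := by
            have := List.mem_singleton.1 (List.mem_of_getElem? h4)
            exact this.symm
          -- The appended entry would give a world satisfying the same set at smaller distance than
          -- `v₀`.
          exact absurd h6 (hmin v' h5)
      · obtain rfl : e = (φ, succSet X a φ) := by simpa using he
        exact absurd h6 (hmin v' h5)
    · have : dist M v₀ φ ≤ dist M v φ := not_lt.1 (hmin v hv)
      omega
  have hst : stateStat H L s f = Status.isOpen := by
    unfold stateStat
    refine if_neg ?_
    rintro ⟨a, φ, h, h' | ⟨ψ, -, -, n, h1, h2⟩⟩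
    · exact h' (hopen a φ h).1
    -- Here `n ≤ i + 1` and i indexes an entry of H, so n cannot exceed its length.
    · obtain ⟨i, h3, e, h4, -⟩ := (hopen a φ h).2 ψ n h1
      have := (List.getElem?_eq_some_iff.1 h4).1
      omega
  refine ⟨hst, fun χ₁ _ χ₂ => ?_⟩
  dsimp only
  unfold stateUev
  split
  · next a φ _ =>
    split_ifs with h
    · obtain ⟨-, -, -, h⟩ := h
      by_cases hb : Blocked X H a φ
      · obtain ⟨j, h1, h2⟩ := hf a φ h hb
        obtain ⟨v, hv, hlt⟩ := hsucc a φ h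
        rw [h2]
        rintro _ ⟨⟩
        -- The blocking entry is its own witness: index j from 0 is position `j + 1`, and its set
        -- holds at the successor v.
        exact ⟨j, by simp, _, h1, v, hv, hlt⟩
      · exact (hopen a φ ((hL a φ).2 ⟨h, hb⟩)).2 χ₂
    · exact uevOk_none _ _
  · exact uevOk_none _ _

/-! ### The induction step -/

/-- The three hypotheses match the three ways the measure drops: `ihF` when π is replaced by
components at the same world, `ihB` when an unblocked `[α*]φ` enters B, `ihS` when a state appends a
new pair to H. Only the last may change the world. -/
theorem ok_of_rule {x : Node} {cs : List Node} {w : M.W} {C : Set Fml} (hr : Rule x cs)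
    (hC : ∀ χ ∈ C, ∀ χ', Sub χ' χ → χ' ∈ C) (hxC : x.fmls ⊆ C) (hx : Guided M x w)
    (ihF : ∀ y ∈ cs, y.HCr = x.HCr → y.BB = x.BB → y.fmls ⊆ C → Guided M y w →
      (∃ Γ K π, x.fmls = insert π Γ ∧ π ∉ Γ ∧ y.fmls = K ∪ Γ ∧ ∀ κ ∈ K, Comp M w κ π) → Ok M y w)
    (ihB : ∀ y ∈ cs, y.HCr = x.HCr → y.fmls ⊆ C → Guided M y w →
      (∃ β ∈ C, β ∉ x.BB ∧ y.BB = insert β x.BB) → Ok M y w)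
    (ihS : ∀ y ∈ cs, ∀ v, y.fmls ⊆ C → Guided M y v →
      (∃ e : Fml × Set Fml, e.1 ∈ C ∧ e.2 ⊆ C ∧ e ∉ x.HCr ∧ y.HCr = x.HCr ++ [e]) → Ok M y v) :
    Ok M x w := by
  obtain ⟨hsat, hch⟩ := hx
  cases hr with
  | id Γ H N D B p hp hn => exact absurd (hsat _ hp) (hsat _ hn)
  | diaStar₂ Γ H N D B α φ hΓ hN hD =>
    obtain ⟨π, h1, h2⟩ := hch _ hD
    dsimp only at h1
    subst h1
    obtain rfl : π = .dia (.star α) φ := by simpa using hN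
    exact absurd h2 (lt_irrefl _)
  | conj Γ H D B s f φ ψ hΓ =>
    simp only [Set.insert_subset_iff, Set.forall_mem_insert] at hxC hsat
    have hπ := hC _ hxC.1
    have h := ihF _ (.head _) rfl rfl
      (by simp [Set.insert_subset_iff, hxC.2, hπ _ (.conj_left _ _), hπ _ (.conj_right _ _)])
      ⟨by rintro χ ((rfl | rfl) | hχ); exacts [hsat.1.1, hsat.1.2, hsat.2 _ hχ], hch⟩
      ⟨Γ, _, _, rfl, hΓ, rfl, by rintro κ (rfl | rfl); exacts [.conj_left _ _, .conj_right _ _]⟩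
    exact ⟨h.1, fun χ₁ _ χ₂ => uevOk_restrict (fun χ hχ => h.2 χ (Or.inr hχ)) _ _⟩
  | boxUnion Γ H D B s f α β φ hΓ =>
    simp only [Set.insert_subset_iff, Set.forall_mem_insert] at hxC hsat
    have hπ := hC _ hxC.1
    have h := ihF _ (.head _) rfl rfl
      (by simp [Set.insert_subset_iff, hxC.2, hπ _ (.box_union_left _ _ _),
        hπ _ (.box_union_right _ _ _)])
      ⟨by
        rintro χ ((rfl | rfl) | hχ)
        exacts [fun v hv => hsat.1 v (.inl hv), fun v hv => hsat.1 v (.inr hv), hsat.2 _ hχ], hch⟩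
      ⟨Γ, _, _, rfl, hΓ, rfl, by
        rintro κ (rfl | rfl); exacts [.box_union_left _ _ _, .box_union_right _ _ _]⟩
    exact ⟨h.1, fun χ₁ _ χ₂ => uevOk_restrict (fun χ hχ => h.2 χ (Or.inr hχ)) _ _⟩
  | boxSeq Γ H D B s f α β φ hΓ =>
    simp only [Set.insert_subset_iff, Set.forall_mem_insert] at hxC hsat
    have hπ := hC _ hxC.1
    have h := ihF _ (.head _) rfl rfl
      (by simp [Set.insert_subset_iff, hxC.2, hπ _ (.box_seq _ _ _)])
      ⟨by
        rintro χ (rfl | hχ)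
        exacts [fun v hv u hu => hsat.1 u ⟨v, hv, hu⟩, hsat.2 _ hχ], hch⟩
      ⟨Γ, {_}, _, rfl, hΓ, rfl, by rintro κ rfl; exact .box_seq _ _ _⟩
    exact ⟨h.1, fun χ₁ _ χ₂ => uevOk_restrict (fun χ hχ => h.2 χ (Or.inr hχ)) _ _⟩
  | boxStarBlocked Γ H D B s f α φ hΓ hB =>
    simp only [Set.insert_subset_iff, Set.forall_mem_insert] at hxC hsat
    -- B does not grow, but π is replaced by nothing, which is a descent with no components;
    -- dropping a formula preserves satisfaction.
    have h := ihF _ (.head _) rfl (Set.insert_eq_of_mem hB) hxC.2 ⟨hsat.2, hch⟩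
      ⟨Γ, ∅, _, rfl, hΓ, (Set.empty_union _).symm, by simp⟩
    exact ⟨h.1, fun χ₁ _ χ₂ => uevOk_restrict h.2 _ _⟩
  | boxStar Γ H D B s f α φ hΓ hB =>
    simp only [Set.insert_subset_iff, Set.forall_mem_insert] at hxC hsat
    have hπ := hC _ hxC.1
    have h := ihB _ (.head _) rfl
      (by simp [Set.insert_subset_iff, hxC.2, hπ _ (.box_star_left _ _),
        hπ _ (.box_star_right _ _)])
      ⟨by
        rintro χ ((rfl | rfl) | hχ)
        exacts [hsat.1 w .refl, fun v hv u hu => hsat.1 u (.head hv hu), hsat.2 _ hχ], hch⟩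
      ⟨_, hxC.1, hB, rfl⟩
    exact ⟨h.1, fun χ₁ _ χ₂ => uevOk_restrict (fun χ hχ => h.2 χ (Or.inr hχ)) _ _⟩
  | diaSeq Γ H N D B s f α β φ hΓ hN =>
    simp only [Set.insert_subset_iff, Set.forall_mem_insert] at hxC hsat
    have hπ := hC _ hxC.1
    have hg := good_seq hsat.1
    have h := ihF _ (.head _) rfl rfl
      (by simp [Set.insert_subset_iff, hxC.2, hπ _ (.dia_seq _ _ _)])
      ⟨by rintro χ (rfl | hχ); exacts [hg.1, hsat.2 _ hχ],
        hch.child hN hg.2 (Set.subset_insert _ _)⟩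
      ⟨Γ, {_}, _, rfl, hΓ, rfl, by rintro κ rfl; exact .dia_seq _ _ _ hg.2⟩
    exact ⟨h.1, fun χ₁ _ χ₂ => uevOk_inherit (fun χ hχ => h.2 χ (Or.inr hχ))
      (h.2 _ (Or.inl rfl)) hg.2 _ _⟩
  | diaTest Γ H N D B s f ψ φ hΓ hN =>
    simp only [Set.insert_subset_iff, Set.forall_mem_insert] at hxC hsat
    have hπ := hC _ hxC.1
    obtain ⟨hψ, hg⟩ := good_test hsat.1
    have h := ihF _ (.head _) rfl rfl
      (by simp [Set.insert_subset_iff, hxC.2, hπ _ (.dia_test_left _ _),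
        hπ _ (.dia_test_right _ _)])
      ⟨by rintro χ ((rfl | rfl) | hχ); exacts [hψ, hg.1, hsat.2 _ hχ],
        hch.child hN hg.2 (Set.subset_insert _ _)⟩
      ⟨Γ, _, _, rfl, hΓ, rfl, by
        rintro κ (rfl | rfl); exacts [.dia_test_left _ _, .dia_test_right _ _ hg.2]⟩
    exact ⟨h.1, fun χ₁ _ χ₂ => uevOk_inherit (fun χ hχ => h.2 χ (Or.inr hχ))
      (h.2 _ (Or.inl (Or.inr rfl))) hg.2 _ _⟩
  | disj Γ H D B s₁ f₁ s₂ f₂ φ₁ φ₂ hΓ =>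
    simp only [Set.insert_subset_iff, Set.forall_mem_insert] at hxC hsat
    have hπ := hC _ hxC.1
    rcases hsat.1 with h1 | h1
    · have h := ihF _ (.head _) rfl rfl
        (by simp [Set.insert_subset_iff, hxC.2, hπ _ (.disj_left _ _)])
        ⟨by rintro χ (rfl | hχ); exacts [h1, hsat.2 _ hχ], hch⟩
        ⟨Γ, {_}, _, rfl, hΓ, rfl, by rintro κ rfl; exact .disj_left _ _⟩
      exact ok_beta_left h.1 (uevOk_restrict (fun χ hχ => h.2 χ (Or.inr hχ)))
    · have h := ihF _ (.tail _ (.head _)) rfl rfl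
        (by simp [Set.insert_subset_iff, hxC.2, hπ _ (.disj_right _ _)])
        ⟨by rintro χ (rfl | hχ); exacts [h1, hsat.2 _ hχ], hch⟩
        ⟨Γ, {_}, _, rfl, hΓ, rfl, by rintro κ rfl; exact .disj_right _ _⟩
      exact ok_beta_right h.1 (uevOk_restrict (fun χ hχ => h.2 χ (Or.inr hχ)))
  | boxTest Γ H D B s₁ f₁ s₂ f₂ ψ φ hΓ =>
    simp only [Set.insert_subset_iff, Set.forall_mem_insert] at hxC hsat
    have hπ := hC _ hxC.1
    by_cases h1 : Sat M ψ w
    · have h := ihF _ (.tail _ (.head _)) rfl rfl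
        (by simp [Set.insert_subset_iff, hxC.2, hπ _ (.box_test_right _ _)])
        ⟨by rintro χ (rfl | hχ); exacts [hsat.1 w ⟨rfl, h1⟩, hsat.2 _ hχ], hch⟩
        ⟨Γ, {_}, _, rfl, hΓ, rfl, by rintro κ rfl; exact .box_test_right _ _⟩
      exact ok_beta_right h.1 (uevOk_restrict (fun χ hχ => h.2 χ (Or.inr hχ)))
    · have h := ihF _ (.head _) rfl rfl
        (by simp [Set.insert_subset_iff, hxC.2, hπ _ (.box_test_left _ _)])
        ⟨by rintro χ (rfl | hχ); exacts [(sat_compl M ψ w).2 h1, hsat.2 _ hχ], hch⟩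
        ⟨Γ, {_}, _, rfl, hΓ, rfl, by rintro κ rfl; exact .box_test_left _ _⟩
      exact ok_beta_left h.1 (uevOk_restrict (fun χ hχ => h.2 χ (Or.inr hχ)))
  | diaUnion Γ H N D B s₁ f₁ s₂ f₂ α₁ α₂ φ hΓ hN =>
    simp only [Set.insert_subset_iff, Set.forall_mem_insert] at hxC hsat
    have hπ := hC _ hxC.1
    rcases good_union hsat.1 with hg | hg
    · have h := ihF _ (.head _) rfl rfl
        (by simp [Set.insert_subset_iff, hxC.2, hπ _ (.dia_union_left _ _ _)])
        ⟨by rintro χ (rfl | hχ); exacts [hg.1, hsat.2 _ hχ],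
          hch.child hN hg.2 (Set.subset_insert _ _)⟩
        ⟨Γ, {_}, _, rfl, hΓ, rfl, by rintro κ rfl; exact .dia_union_left _ _ _ hg.2⟩
      exact ok_beta_left h.1 (uevOk_inherit (fun χ hχ => h.2 χ (Or.inr hχ))
        (h.2 _ (Or.inl rfl)) hg.2)
    · have h := ihF _ (.tail _ (.head _)) rfl rfl
        (by simp [Set.insert_subset_iff, hxC.2, hπ _ (.dia_union_right _ _ _)])
        ⟨by rintro χ (rfl | hχ); exacts [hg.1, hsat.2 _ hχ],
          hch.child hN hg.2 (Set.subset_insert _ _)⟩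
        ⟨Γ, {_}, _, rfl, hΓ, rfl, by rintro κ rfl; exact .dia_union_right _ _ _ hg.2⟩
      exact ok_beta_right h.1 (uevOk_inherit (fun χ hχ => h.2 χ (Or.inr hχ))
        (h.2 _ (Or.inl rfl)) hg.2)
  | diaStar₁ Γ H N D B s₁ f₁ s₂ f₂ α φ hΓ hN hD =>
    simp only [Set.insert_subset_iff, Set.forall_mem_insert] at hxC hsat
    have hπ := hC _ hxC.1
    rcases good_star hsat.1 with hg | hg
    · have h := ihF _ (.head _) rfl rfl
        (by simp [Set.insert_subset_iff, hxC.2, hπ _ (.dia_star_left _ _)])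
        ⟨by rintro χ (rfl | hχ); exacts [hg.1, hsat.2 _ hχ], hch.child hN hg.2 subset_rfl⟩
        ⟨Γ, {_}, _, rfl, hΓ, rfl, by rintro κ rfl; exact .dia_star_left _ _ hg.2⟩
      exact ok_beta_left h.1 (uevOk_inheritStar (fun χ hχ => h.2 χ (Or.inr hχ))
        (h.2 _ (Or.inl rfl)) hg.2)
    · have h := ihF _ (.tail _ (.head _)) rfl rfl
        (by simp [Set.insert_subset_iff, hxC.2, hπ _ (.dia_star_right _ _)])
        ⟨by rintro χ (rfl | hχ); exacts [hg.1, hsat.2 _ hχ], hch.child hN hg.2 subset_rfl⟩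
        ⟨Γ, {_}, _, rfl, hΓ, rfl, by rintro κ rfl; exact .dia_star_right _ _ hg.2⟩
      exact ok_beta_right h.1 (uevOk_inherit (fun χ hχ => h.2 χ (Or.inr hχ))
        (h.2 _ (Or.inl rfl)) hg.2)
  | state X H N D B L s f hX hcons hnodup hL hf =>
    -- Each child starts with D empty, so being guided at v only requires its formulae to hold
    -- there.
    refine ok_state hL hf hsat fun a φ h v hv => ?_
    have ⟨hφ, hb⟩ := (hL a φ).1 h
    have hsub : succSet X a φ ⊆ C := by
      rintro ψ (rfl | hψ)
      exacts [hC _ (hxC hφ) _ (.dia_atom _ _), hC _ (hxC hψ) _ (.box_atom _ _)]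
    exact ihS _ (List.mem_map.2 ⟨(a, φ), h, rfl⟩) v hsub ⟨hv, chainOk_empty _ _⟩
      ⟨(φ, succSet X a φ), hsub (Or.inl rfl), hsub, hb, rfl⟩

/-! ### Completeness -/

/-- Let `E` be a set of nodes to each of which a rule is applied with children in `E`. Every node
in `E` that is satisfied by a model along a guided path is open. -/
theorem ok_of_guided {E : Node → Prop}
    (hE : ∀ x, E x → ∃ cs, Rule x cs ∧ ∀ y ∈ cs, E y) {C : Set Fml} (hfin : C.Finite)
    (hC : ∀ χ ∈ C, ∀ χ', Sub χ' χ → χ' ∈ C) (x : Node) (w : M.W) (hx : E x) (hxC : x.fmls ⊆ C)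
    (hg : Guided M x w) : Ok M x w := by
  classical
  have hPfin : (C ×ˢ 𝒫 C).Finite := hfin.prod hfin.finite_subsets
  induction hk : ((C ×ˢ 𝒫 C) \ {e | e ∈ x.HCr}).ncard using Nat.strong_induction_on
    generalizing x w with
  | _ k ihS =>
  -- From here on w stays fixed, since `Comp M w` depends on it; B may restart empty at a state
  -- because the outer measure has dropped.
  induction hl : (C \ x.BB).ncard using Nat.strong_induction_on generalizing x with
  | _ l ihB =>
  obtain ⟨F, hF⟩ : ∃ F : Finset Fml, (F : Set Fml) = x.fmls :=
    ⟨(hfin.subset hxC).toFinset, (hfin.subset hxC).coe_toFinset⟩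
  induction F using (wellFounded_setLt (M := M) w).induction generalizing x with
  | _ F ihF =>
  obtain ⟨cs, hr, hcs⟩ := hE x hx
  refine ok_of_rule hr hC hxC hg ?_ ?_ ?_
  · rintro y hy hH hB hyC hyg ⟨Γ, K, π, h1, h2, h3, h4⟩
    have hfy := hfin.subset hyC
    rw [h3] at hfy
    obtain ⟨K, rfl⟩ := (hfy.subset Set.subset_union_left).exists_finset_coe
    obtain ⟨Γ, rfl⟩ := (hfy.subset Set.subset_union_right).exists_finset_coe
    obtain rfl : F = insert π Γ := by
      apply Finset.coe_injective
      rw [hF, h1, Finset.coe_insert]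
    exact ihF (K ∪ Γ) (setLt_of_comp h2 h4) y (hcs y hy) hyC hyg (by rw [hH, hk])
      (by rw [hB, hl]) (by rw [h3, Finset.coe_union])
  · rintro y hy hH hyC hyg ⟨β, hβ, hβ', hB⟩
    refine ihB _ ?_ y (hcs y hy) hyC hyg (by rw [hH, hk]) rfl
    rw [← hl, hB]
    refine Set.ncard_lt_ncard ⟨fun χ h => ⟨h.1, fun h' => h.2 (Or.inr h')⟩, fun h => ?_⟩
      (hfin.subset Set.sdiff_subset)
    exact (h ⟨hβ, hβ'⟩).2 (Or.inl rfl)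
  · rintro y hy v hyC hyg ⟨e, he1, he2, he3, hH⟩
    refine ihS _ ?_ y v (hcs y hy) hyC hyg rfl
    rw [← hk, hH]
    refine Set.ncard_lt_ncard ⟨fun χ h => ⟨h.1, fun h' => h.2 ?_⟩, fun h => ?_⟩
      (hPfin.subset Set.sdiff_subset)
    · exact List.mem_append_left _ h'
    · exact (h ⟨⟨he1, he2⟩, he3⟩).2 (List.mem_append_right _ (List.mem_singleton_self e))

end PDL

theorem mainTheorem3 (φ : PDL.Fml) (hφ : φ.IsNNF) (T : PDL.Tree)
    (hT : PDL.IsExpandedTableauFor T φ) (r : PDL.Node) (hr : T [] = some r)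
    (hstat : r.IsClosed ∨ r.IsBarred) :
    ¬ PDL.Satisfiable.{u} φ := by
  rintro ⟨M, w, hw⟩
  obtain ⟨S, hfin, hφS, hS⟩ := PDL.finClosed φ
  obtain ⟨stat, uev, hroot⟩ := hT.root
  rw [hr] at hroot
  cases hroot
  -- Only closure under children matters, so the class of all nodes occurring in T serves, whether
  -- or not T is finite.
  have h : PDL.Ok M _ w := PDL.ok_of_guided (E := fun x => ∃ p, T p = some x)
    (fun x ⟨p, hp⟩ => by
      obtain ⟨cs, h1, h2⟩ := hT.rule p x hp
      refine ⟨cs, h1, fun y hy => ?_⟩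
      obtain ⟨i, hi⟩ := List.mem_iff_getElem?.1 hy
      exact ⟨p ++ [i], by rw [h2, hi]⟩)
    hfin (fun χ hχ χ' h => (hS χ hχ χ' h).resolve_right id) _ w ⟨[], hr⟩
    (Set.singleton_subset_iff.2 hφS) ⟨by rintro ψ rfl; exact hw, PDL.chainOk_empty _ _⟩
  have hopen := h.1
  rcases hstat with hs | hs
  · exact absurd (hs.symm.trans hopen) (by simp)
  · exact absurd (hs.symm.trans hopen) (by simp)
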